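/- Let $n,r\ge 0$ be integers, $[n]=\{1,\dots,n\}$, $\Delta^r_n=\{\alpha\in\mathbb N^n\mid \alpha_1+\dots+\alpha_n=r\}$, and let $\epsilon_i$ denote the $i$-th standard basis vector. A *polymatroid* (or M-convex set) of rank $r$ on $[n]$ is a nonempty subset $J\subseteq\Delta^r_n$ such that for all $\alpha,\beta\in J$ and every $i$ with $\alpha_i<\beta_i$ there is a $j$ with $\alpha_j>\beta_j$ such that $\alpha+\epsilon_i-\epsilon_j\in J$ and $\beta-\epsilon_i+\epsilon_j\in J$. Put $\delta^-_J=\inf J$ and $\delta^+_J=\sup J$ (component-wise). The *tropical hyperfield* $\mathbb T_0$ is the tract with underlying multiplicative monoid $\mathbb R_{\ge0}$, with $-1=1$, and with null set $N_{\mathbb T_0}\subseteq\mathbb N[\mathbb R_{>0}]$ consisting of the formal sums $\sum a_i$ in which the maximum of the $a_i$ appears at least twice (including the empty sum; zero summands are omitted from formal sums). Let $J\subseteq\Delta^r_n$ be a polymatroid and let $\rho\colon\Delta^r_n\to\mathbb T_0$ be a map with support $\{\alpha\mid\rho(\alpha)\ne0\}$ equal to $J$. The map $\rho$ is a *strong $\mathbb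 T_0$-representation* of $J$ if $$\sum_{k=0}^s \rho(\alpha-\epsilon_{i_k}+\epsilon_{i_0}+\dots+\epsilon_{i_s})\cdot\rho(\alpha+\epsilon_{i_k}+\epsilon_{j_2}+\dots+\epsilon_{j_s})\in N_{\mathbb T_0}$$ for all $2\le s\le r$, all $\alpha\in\Delta^{r-s}_n$ with $\delta^-_J\le\alpha$, and all $i_0,\dots,i_s,j_2,\dots,j_s\in[n]$ with $\alpha+\epsilon_{i_0}+\dots+\epsilon_{i_s}+\epsilon_{j_2}+\dots+\epsilon_{j_s}\le\delta^+_J$. It is a *weak $\mathbb T_0$-representation* of $J$ if $r<2$ or $$\rho(\alpha+\epsilon_j+\epsilon_k)\rho(\alpha+\epsilon_i+\epsilon_l)+\rho(\alpha+\epsilon_i+\epsilon_k)\rho(\alpha+\epsilon_j+\epsilon_l)+\rho(\alpha+\epsilon_i+\epsilon_j)\rho(\alpha+\epsilon_k+\epsilon_l)\in N_{\mathbb T_0}$$ for all $\alpha\in\Delta^{r-2}_n$ with $\delta^-_J\le\alpha$ and all $i,j,k,l\in[n]$ with $\alpha+\epsilon_i+\epsilon_j+\epsilon_k+\epsilon_l\le\delta^+_J$.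 (By symmetry and since $-1=1$, it is the same to require these relations only for $i_0\le\dots\le i_s$, $j_2\le\dots\le j_s$ and for $i\le j\le k\le l$, respectively.) A function $f\colon\mathbb Z^n\to\mathbb R\cup\{\infty\}$ is *M-convex* (in the sense of Murota) if it is not identically $\infty$ and if for all $\alpha,\beta\in\mathbb Z^n$ with $f(\alpha),f(\beta)\neq\infty$ and every $k$ with $\alpha_k>\beta_k$ there is an $l$ with $\alpha_l<\beta_l$ and $f(\alpha)+f(\beta)\ge f(\alpha-\epsilon_k+\epsilon_l)+f(\beta+\epsilon_k-\epsilon_l)$. A function on $\Delta^r_n$ is considered as a function on $\mathbb Z^n$ by giving it the value $\infty$ outside $\Delta^r_n$. **Proposition.** Let $\rho\colon\Delta^r_n\to\mathbb T_0$ be a map with support $J$. Then $-\log\rho\colon\Delta^r_n\to\mathbb R\cup\{\infty\}$ (with $-\log 0=\infty$) is an M-convex function if and only if $J$ is a polymatroid and $\rho$ is a strong $\mathbb T_0$-representation of $J$. Likewise, $-\log\rho$ is an M-convex function if and only if $J$ is a polymatroid and $\rho$ is a weak $\mathbb T_0$-representation of $J$. -/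

import Mathlib

open scoped NNReal

noncomputable section

namespace PolymatroidRep

/-! ### Tracts -/

/-- The canonical map `F → F⁺ = ℕ[Fˣ]` of a pointed group into its ambient semiring:
`0` goes to the empty sum and a unit `a` goes to the formal sum `1.a`. -/
def formal {F : Type*} [CommGroupWithZero F] (a : F) : MonoidAlgebra ℕ Fˣ :=
  open Classical in if h : a = 0 then 0 else MonoidAlgebra.single (Units.mk0 a h) 1

/-- A tract structure on a pointed abelian group `F` (a commutative monoid with absorbing element
`0` whose nonzero elements form a group): an ideal `nullSet` of the group semiring `ℕ[Fˣ]` and an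
element `-1` of `F` such that `a + b` is null if and only if `b = (-1) * a`. -/
structure Tract (F : Type*) [CommGroupWithZero F] where
  /-- the null set `N_F` -/
  nullSet : Ideal (MonoidAlgebra ℕ Fˣ)
  /-- the element `-1` -/
  negOne : F
  formal_add_formal_mem_iff : ∀ a b : F, formal a + formal b ∈ nullSet ↔ b = negOne * a

/-- A formal sum of positive real numbers is tropically null if its maximum appears at least
twice (the empty sum is null). -/
def TropNull (x : MonoidAlgebra ℕ ℝ≥0ˣ) : Prop :=
  ∀ m : ℝ≥0ˣ, x.coeff m ≠ 0 → (∀ a : ℝ≥0ˣ, x.coeff a ≠ 0 → (a : ℝ≥0) ≤ (m : ℝ≥0)) →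
    2 ≤ x.coeff m

theorem TropNull.add {x y : MonoidAlgebra ℕ ℝ≥0ˣ} (hx : TropNull x) (hy : TropNull y) :
    TropNull (x + y) := by
  intro m hm hmax
  simp only [MonoidAlgebra.coeff_add, Finsupp.add_apply] at hm hmax ⊢
  by_cases h : x.coeff m = 0
  · have := hy m (by omega) (fun a ha => hmax a (by omega))
    omega
  · have := hx m h (fun a ha => hmax a (by omega))
    omega

theorem TropNull.single_mul (u : ℝ≥0ˣ) (n : ℕ) {x : MonoidAlgebra ℕ ℝ≥0ˣ} (hx : TropNull x) :
    TropNull (MonoidAlgebra.single u n * x) := by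
  have key : ∀ b, (MonoidAlgebra.single u n * x).coeff b = n * x.coeff (u⁻¹ * b) := fun b => by
    simp
  intro m hm hmax
  rw [key] at hm ⊢
  have hn : n ≠ 0 := left_ne_zero_of_mul hm
  have := hx (u⁻¹ * m) (right_ne_zero_of_mul hm) (fun a ha => by
    have h := hmax (u * a) (by rw [key, inv_mul_cancel_left]; exact mul_ne_zero hn ha)
    have h' : ((u⁻¹ * (u * a) : ℝ≥0ˣ) : ℝ≥0) ≤ ((u⁻¹ * m : ℝ≥0ˣ) : ℝ≥0) := by
      rw [Units.val_mul u⁻¹, Units.val_mul u⁻¹]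
      exact mul_le_mul_right h _
    rwa [inv_mul_cancel_left] at h')
  have h1 : 1 ≤ n := Nat.one_le_iff_ne_zero.mpr hn
  nlinarith

theorem TropNull.mul (c : MonoidAlgebra ℕ ℝ≥0ˣ) {x : MonoidAlgebra ℕ ℝ≥0ˣ} (hx : TropNull x) :
    TropNull (c * x) := by
  induction c using MonoidAlgebra.induction_linear with
  | zero => intro m hm; simp at hm
  | add a b ha hb => rw [add_mul]; exact ha.add hb
  | single u n => exact hx.single_mul u n

theorem tropNull_formal_add_formal_iff (a b : ℝ≥0) :
    TropNull (formal a + formal b) ↔ b = 1 * a := by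
  classical
  rw [one_mul]
  by_cases ha : a = 0 <;> by_cases hb : b = 0
  · subst ha hb
    simp [formal, TropNull]
  · subst ha
    simp only [formal, dif_pos, zero_add, hb, iff_false]
    intro h
    have := h (Units.mk0 b hb) (by simp) (fun c hc => by
      by_cases hcb : Units.mk0 b hb = c
      · simp [← hcb]
      · simp [hcb] at hc)
    simp at this
  · subst hb
    simp only [formal, dif_neg ha, dif_pos, add_zero, Ne.symm ha, iff_false]
    intro h
    have := h (Units.mk0 a ha) (by simp) (fun c hc => by
      by_cases hcb : Units.mk0 a ha = c
      · simp [← hcb]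
      · simp [hcb] at hc)
    simp at this
  · simp only [formal, dif_neg ha, dif_neg hb]
    constructor
    · intro h
      by_contra hab
      rcases le_total a b with hle | hle
      · have := h (Units.mk0 b hb) (by simp) (fun c hc => by
          by_cases h1 : Units.mk0 a ha = c
          · simp [← h1, hle]
          by_cases h2 : Units.mk0 b hb = c
          · simp [← h2]
          simp [h1, h2] at hc)
        simp [Ne.symm hab] at this
      · have := h (Units.mk0 a ha) (by simp) (fun c hc => by
          by_cases h1 : Units.mk0 a ha = c
          · simp [← h1]
          by_cases h2 : Units.mk0 b hb = c
          · simp [← h2, hle]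
          simp [h1, h2] at hc)
        simp [hab] at this
    · rintro rfl m hm -
      by_cases h1 : Units.mk0 b hb = m
      · simp [h1]
      · simp [h1] at hm

/-- The tropical hyperfield `T₀`: the pointed group `ℝ≥0` (with the usual multiplication), where a
formal sum is null if its maximum appears at least twice, and `-1 = 1`. -/
def tropicalHyperfield : Tract ℝ≥0 where
  nullSet :=
    { carrier := {x | TropNull x}
      add_mem' := fun hx hy => TropNull.add hx hy
      zero_mem' := fun m hm => by simp at hm
      smul_mem' := fun c _ hx => TropNull.mul c hx }
  negOne := 1
  formal_add_formal_mem_iff := tropNull_formal_add_formal_iff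

/-! ### M-convex sets (polymatroids) -/

/-- The discrete simplex `Δ^r_n` of all `α ∈ ℕⁿ` with `α₁ + ⋯ + αₙ = r`. -/
def Delta (n r : ℕ) : Set (Fin n → ℕ) := {α | ∑ i, α i = r}

/-- The standard basis vector `ε_i` of `ℕⁿ`. -/
def eps {n : ℕ} (i : Fin n) : Fin n → ℕ := Pi.single i 1

/-- `J` is (the set of bases of) a discrete polymatroid of rank `r` on `[n]`, i.e. an M-convex
set: a nonempty subset of `Δ^r_n` with the symmetric exchange property. -/
structure IsPolymatroid (n r : ℕ) (J : Set (Fin n → ℕ)) : Prop where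
  subset : J ⊆ Delta n r
  nonempty : J.Nonempty
  exchange : ∀ α ∈ J, ∀ β ∈ J, ∀ i, α i < β i →
    ∃ j, β j < α j ∧ α + eps i - eps j ∈ J ∧ β + eps j - eps i ∈ J

/-- The infimum `δ⁻_J` of `J` in `ℕⁿ`. -/
def deltaMinus {n : ℕ} (J : Set (Fin n → ℕ)) : Fin n → ℕ := fun i => sInf ((fun α => α i) '' J)

/-- The supremum `δ⁺_J` of `J` in `ℕⁿ`; it is used for sets `J ⊆ Δ^r_n`, which are bounded. -/
def deltaPlus {n : ℕ} (J : Set (Fin n → ℕ)) : Fin n → ℕ := fun i => sSup ((fun α => α i) '' J)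

/-! ### Representations over a tract -/

/-- The value of `ρ : Δ^r_n → F` at a vector of `ℕⁿ`, extended by `0` outside `Δ^r_n`. In the
Plücker relations below all arguments lie in `Δ^r_n`. -/
def val {n r : ℕ} {F : Type*} [Zero F] (ρ : Delta n r → F) (α : Fin n → ℕ) : F :=
  open Classical in if h : α ∈ Delta n r then ρ ⟨α, h⟩ else 0

/-- The support of a function `ρ : Δ^r_n → F`. -/
def supp {n r : ℕ} {F : Type*} [Zero F] (ρ : Delta n r → F) : Set (Fin n → ℕ) :=
  {α | ∃ h : α ∈ Delta n r, ρ ⟨α, h⟩ ≠ 0}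

/-- The exponent `k + σ(k)` of the sign in the Plücker relations, where `σ(k)` is the number of
indices `l` with `i_k < j_l`. -/
def signExp {n s : ℕ} (i : Fin (s + 1) → Fin n) (j : Fin (s - 1) → Fin n) (k : Fin (s + 1)) : ℕ :=
  (k : ℕ) + (Finset.univ.filter fun l => i k < j l).card

/-- `ρ : Δ^r_n → F` is a strong (Grassmann–Plücker) representation of the polymatroid `J ⊆ Δ^r_n`
over the tract `T` on `F`. The tuple `j` stands for `(j₂, …, j_s)`, and
`∑ l ∈ univ.erase k, ε_{i_l}` is `-ε_{i_k} + ε_{i_0} + ⋯ + ε_{i_s}`. -/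
structure IsStrongRepresentation {n r : ℕ} {F : Type*} [CommGroupWithZero F] (T : Tract F)
    (J : Set (Fin n → ℕ)) (ρ : Delta n r → F) : Prop where
  isPolymatroid : IsPolymatroid n r J
  supp_eq : supp ρ = J
  plucker : ∀ s : ℕ, 2 ≤ s → s ≤ r → ∀ α ∈ Delta n (r - s),
    ∀ (i : Fin (s + 1) → Fin n) (j : Fin (s - 1) → Fin n), Monotone i → Monotone j →
    deltaMinus J ≤ α → α + ∑ l, eps (i l) + ∑ l, eps (j l) ≤ deltaPlus J →
    ∑ k : Fin (s + 1), formal (T.negOne ^ signExp i j k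
        * val ρ (α + ∑ l ∈ Finset.univ.erase k, eps (i l))
        * val ρ (α + eps (i k) + ∑ l, eps (j l))) ∈ T.nullSet

/-- `ρ : Δ^r_n → F` is a weak representation of the polymatroid `J ⊆ Δ^r_n` over the tract `T`
on `F`: it satisfies the 3-term Plücker relations. -/
structure IsWeakRepresentation {n r : ℕ} {F : Type*} [CommGroupWithZero F] (T : Tract F)
    (J : Set (Fin n → ℕ)) (ρ : Delta n r → F) : Prop where
  isPolymatroid : IsPolymatroid n r J
  supp_eq : supp ρ = J
  plucker : 2 ≤ r → ∀ α ∈ Delta n (r - 2), ∀ i j k l : Fin n, i ≤ j → j ≤ k → k ≤ l →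
    deltaMinus J ≤ α → α + eps i + eps j + eps k + eps l ≤ deltaPlus J →
    formal (val ρ (α + eps j + eps k) * val ρ (α + eps i + eps l))
      + formal (T.negOne * (val ρ (α + eps i + eps k) * val ρ (α + eps j + eps l)))
      + formal (val ρ (α + eps i + eps j) * val ρ (α + eps k + eps l)) ∈ T.nullSet

/-! ### M-convex functions -/

/-- The standard basis vector `ε_i` of `ℤⁿ`. -/
def epsZ {n : ℕ} (i : Fin n) : Fin n → ℤ := Pi.single i 1

/-- M-convex functions `f : ℤⁿ → ℝ ∪ {∞}` in the sense of Murota. -/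
structure IsMConvexFunction {n : ℕ} (f : (Fin n → ℤ) → WithTop ℝ) : Prop where
  nonempty : ∃ α, f α ≠ ⊤
  exchange : ∀ α β : Fin n → ℤ, f α ≠ ⊤ → f β ≠ ⊤ → ∀ k, β k < α k →
    ∃ l, α l < β l ∧ f (α - epsZ k + epsZ l) + f (β + epsZ k - epsZ l) ≤ f α + f β

/-- `-log : ℝ≥0 → ℝ ∪ {∞}`, with `-log 0 = ∞`. -/
def negLog (x : ℝ≥0) : WithTop ℝ :=
  open Classical in if x = 0 then ⊤ else ((-Real.log (x : ℝ) : ℝ) : WithTop ℝ)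

/-- A function `Δ^r_n → ℝ ∪ {∞}` considered as a function on `ℤⁿ`, with value `∞` outside
`Δ^r_n`. -/
def extendByTop {n r : ℕ} (g : Delta n r → WithTop ℝ) (x : Fin n → ℤ) : WithTop ℝ :=
  open Classical in
  if h : (∀ i, 0 ≤ x i) ∧ (fun i => (x i).toNat) ∈ Delta n r then g ⟨fun i => (x i).toNat, h.2⟩
  else ⊤

end PolymatroidRep

end

namespace PolymatroidRep

/-! Extend `ρ` by zero to a function `R` on `ℤⁿ`. Through `-log`, M-convexity says that `R x * R y`
is at most some exchanged product `R (x - ε_u + ε_v) * R (y + ε_u - ε_v)`. The proof runs in a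
circle: M-convex ⇒ strong ⇒ weak ⇒ M-convex.

M-convex ⇒ strong: with `X = α + ∑ ε_{i_l}` and `Y = α + ∑ ε_{j_l}`, every Plücker term is `R (X -
ε_{i_k}) * R (Y + ε_{i_k})`. Exchanging in direction `i_k` turns term `k` into another term that is
at least as large, so a maximal term never stands alone.

Strong ⇒ weak is the case `s = 2`. For weak ⇒ M-convex, the three-term relations are the exchange
inequality for pairs at distance four (`IsWeakRepresentation.three_term`). Since the support is
M-convex, `exchange_of_local` spreads this to all pairs, by Murota's local-to-global argument. -/

/-! ### From local to global exchange -/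

/-- A nonnegative function on `ℤ^ι` with M-convex support that satisfies the exchange inequality
for pairs at distance four satisfies it for all pairs. -/
theorem exchange_of_local {n : ℕ} (R : (Fin n → ℤ) → ℝ≥0)
    (hsum : ∀ x y, R x ≠ 0 → R y ≠ 0 → ∑ i, x i = ∑ i, y i)
    (hdom : ∀ x y, R x ≠ 0 → R y ≠ 0 → ∀ u, y u < x u →
      ∃ v, x v < y v ∧ R (y + epsZ u - epsZ v) ≠ 0)
    (hloc : ∀ y i j k l, k ≠ i → k ≠ j → l ≠ i → l ≠ j → R y ≠ 0 →
      R (y + epsZ i - epsZ k + epsZ j - epsZ l) ≠ 0 →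
      R (y + epsZ i - epsZ k + epsZ j - epsZ l) * R y ≤
        max (R (y + epsZ i - epsZ k) * R (y + epsZ j - epsZ l))
          (R (y + epsZ i - epsZ l) * R (y + epsZ j - epsZ k)))
    (x y : Fin n → ℤ) (hx : R x ≠ 0) (hy : R y ≠ 0) (u : Fin n) (hu : y u < x u) :
    ∃ v, x v < y v ∧ R x * R y ≤ R (x - epsZ u + epsZ v) * R (y + epsZ u - epsZ v) := by
  induction hN : ∑ i, (x i - y i).toNat using Nat.strong_induction_on generalizing y with
  | _ N ih =>
  -- Here `x` and `y` differ by a single exchange, which merely swaps them. Otherwise some `w`,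
  -- possibly `u` itself, leaves room to move `y` towards `x` and still have `y' u < x u`.
  by_cases hbase : ∀ w, x w ≤ (y + epsZ u) w
  · obtain ⟨v, hv, -⟩ := hdom x y hx hy u hu
    have hle : ∀ w, x w ≤ (y + epsZ u - epsZ v) w := by
      intro w
      have := hbase w
      by_cases hw : w = v
      · subst hw
        have huw : w ≠ u := by rintro rfl; omega
        simp only [Pi.add_apply, Pi.sub_apply, epsZ, Pi.single_eq_same,
          Pi.single_eq_of_ne huw] at this ⊢
        omega
      · simpa [epsZ, Pi.single_eq_of_ne hw] using this
    have heq : x = y + epsZ u - epsZ v := by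
      have h : ∑ i, x i = ∑ i, (y + epsZ u - epsZ v) i := by
        rw [hsum x y hx hy]
        simp [epsZ, Finset.sum_add_distrib]
      exact funext fun w => (Finset.sum_eq_sum_iff_of_le fun i _ => hle i).1 h w (Finset.mem_univ w)
    refine ⟨v, hv, ?_⟩
    have h1 : x - epsZ u + epsZ v = y := by rw [heq]; abel
    rw [h1, ← heq, mul_comm]
  · push Not at hbase
    obtain ⟨w, hw⟩ := hbase
    by_contra! hfail
    have hwx : y w < x w := by
      by_cases h : w = u
      · rw [h]; exact hu
      · simpa [epsZ, Pi.single_eq_of_ne h] using hw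
    -- Multiplicative potential: `q v` is the ratio `R x / R (x - ε_u + ε_v)`, and failure of the
    -- exchange bounds `R (y + ε_u - ε_v)` by `R y * q v`. If the denominator vanishes, any large
    -- enough `q v` serves.
    have hq : ∀ v, ∃ q : ℝ≥0, 0 < q ∧ (x v < y v →
        (R (x - epsZ u + epsZ v) ≠ 0 → R (x - epsZ u + epsZ v) * q = R x) ∧
        R (y + epsZ u - epsZ v) < R y * q) := by
      intro v
      by_cases h0 : R (x - epsZ u + epsZ v) = 0
      · refine ⟨(R (y + epsZ u - epsZ v) + 1) / R y, by positivity,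
          fun _ => ⟨fun h => (h h0).elim, ?_⟩⟩
        rw [mul_div_cancel₀ _ hy]
        exact lt_add_one _
      · refine ⟨R x / R (x - epsZ u + epsZ v), by positivity, fun hv =>
          ⟨fun _ => mul_div_cancel₀ _ h0, ?_⟩⟩
        rw [← mul_div_assoc, lt_div_iff₀ (by positivity), mul_comm, mul_comm (R y)]
        exact hfail v hv
    choose q hq0 hq using hq
    obtain ⟨v₁, hv₁, hR₁⟩ := hdom x y hx hy w hwx
    -- Maximizing the weighted value makes `v₀` comparable with whatever `v` the induction
    -- hypothesis returns for `y'`.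
    obtain ⟨v₀, hv₀, hmax⟩ := Finset.exists_max_image
      (Finset.univ.filter fun v => x v < y v) (fun v => R (y + epsZ w - epsZ v) / q v)
      ⟨v₁, by simpa using hv₁⟩
    simp only [Finset.mem_filter, Finset.mem_univ, true_and] at hv₀ hmax
    set y' := y + epsZ w - epsZ v₀ with hy'
    have hy'0 : R y' ≠ 0 := by
      have h1 := hmax v₁ hv₁
      have h2 : 0 < R (y + epsZ w - epsZ v₁) / q v₁ := div_pos (pos_iff_ne_zero.2 hR₁) (hq0 _)
      intro h
      rw [h, zero_div] at h1
      exact absurd (h2.trans_le h1) (lt_irrefl _)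
    have hv₀w : v₀ ≠ w := by rintro rfl; omega
    have hv₀u : v₀ ≠ u := by rintro rfl; omega
    have hu' : y' u < x u := by
      by_cases h : w = u
      · subst h
        simpa [hy', epsZ, Pi.single_eq_of_ne hv₀u.symm] using hw
      · simpa [hy', epsZ, Pi.single_eq_of_ne hv₀u.symm, Pi.single_eq_of_ne (Ne.symm h)] using hu
    have hlt : ∑ i, (x i - y' i).toNat < N := by
      rw [← hN]
      refine Finset.sum_lt_sum (fun i _ => ?_) ⟨w, Finset.mem_univ _, ?_⟩
      · simp only [hy', Pi.add_apply, Pi.sub_apply, epsZ, Pi.single_apply]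
        split_ifs with h1 h2 h2
        · omega
        · omega
        · subst h2; omega
        · omega
      · simp only [hy', Pi.add_apply, Pi.sub_apply, epsZ, Pi.single_eq_same,
          Pi.single_eq_of_ne hv₀w.symm]
        omega
    obtain ⟨v, hv, hexc⟩ := ih _ hlt y' hy'0 hu' rfl
    have hvy : x v < y v := by
      by_cases h : v = w
      · subst h
        have : y' v = y v + 1 := by simp [hy', epsZ, Pi.single_eq_of_ne hv₀w.symm]
        simp only [Pi.add_apply, epsZ] at hw
        by_cases h' : v = u
        · subst h'; omega
        · rw [Pi.single_eq_of_ne h'] at hw; omega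
      · have : y' v ≤ y v := by
          simp only [hy', Pi.add_apply, Pi.sub_apply, epsZ, Pi.single_apply]
          split_ifs <;> omega
        omega
    have hvw : v ≠ w := by rintro rfl; omega
    have hvu : v ≠ u := by rintro rfl; omega
    have hprod : R x * R y' ≠ 0 := mul_ne_zero hx hy'0
    have hne : R (x - epsZ u + epsZ v) * R (y' + epsZ u - epsZ v) ≠ 0 :=
      fun h => hprod (le_antisymm (h ▸ hexc) zero_le)
    have hxv := left_ne_zero_of_mul hne
    have hyv := right_ne_zero_of_mul hne
    obtain ⟨hqx, hqv⟩ := hq v hvy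
    have hqv₀ := (hq v₀ hv₀).2
    have hm := hmax v hvy
    rw [div_le_div_iff₀ (hq0 _) (hq0 _)] at hm
    have hypos := pos_iff_ne_zero.2 hy
    have hy'pos := pos_iff_ne_zero.2 hy'0
    -- Local exchange between `y' + ε_u - ε_v` and `y`: the potential bound at `v` settles one
    -- alternative, the bound at `v₀` and the maximality of `v₀` the other. Multiplying by `R (x -
    -- ε_u + ε_v)` then contradicts `hexc`.
    have key : R (y' + epsZ u - epsZ v) * R y < R y' * q v * R y := by
      rcases le_max_iff.1 (hloc y w u v₀ v hv₀w hv₀u hvw hvu hy hyv) with h | h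
      · calc _ ≤ R y' * R (y + epsZ u - epsZ v) := h
          _ < R y' * (R y * q v) := mul_lt_mul_of_pos_left hqv hy'pos
          _ = _ := by ring
      · have hpos : 0 < R (y + epsZ w - epsZ v) := by
          refine pos_iff_ne_zero.2 fun h0 => mul_ne_zero hyv hy (le_antisymm ?_ zero_le)
          rwa [h0, zero_mul] at h
        calc _ ≤ R (y + epsZ w - epsZ v) * R (y + epsZ u - epsZ v₀) := h
          _ < R (y + epsZ w - epsZ v) * (R y * q v₀) := mul_lt_mul_of_pos_left hqv₀ hpos
          _ = R (y + epsZ w - epsZ v) * q v₀ * R y := by ring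
          _ ≤ _ := mul_le_mul_left hm _
    have key' := lt_of_mul_lt_mul_right key zero_le
    refine absurd hexc (not_le.2 ?_)
    calc _ < R (x - epsZ u + epsZ v) * (R y' * q v) :=
          mul_lt_mul_of_pos_left key' (pos_iff_ne_zero.2 hxv)
      _ = R (x - epsZ u + epsZ v) * q v * R y' := by ring
      _ = _ := by rw [hqx hxv]

/-! ### Tropically null sums -/

theorem coeff_formal (a : ℝ≥0) (m : ℝ≥0ˣ) [Decidable (a = m)] :
    (formal a).coeff m = if a = m then 1 else 0 := by
  classical
  by_cases ha : a = 0
  · simp [formal, ha, m.ne_zero.symm]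
  · have : Units.mk0 a ha = m ↔ a = m := by
      rw [← Units.val_inj, Units.val_mk0]
    simp [formal, ha, Finsupp.single_apply, this]

/-- The coefficient at `m` counts the indices with value `m`, so a second index attaining the
maximum suffices. -/
theorem tropNull_sum_formal {κ : Type*} [Fintype κ] (a : κ → ℝ≥0)
    (h : ∀ k, a k ≠ 0 → (∀ k', a k' ≤ a k) → ∃ k', k' ≠ k ∧ a k' = a k) :
    TropNull (∑ k, formal (a k)) := by
  classical
  have hc : ∀ m : ℝ≥0ˣ, (∑ k, formal (a k)).coeff m =
      (Finset.univ.filter fun k => a k = m).card := by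
    intro m
    simp [MonoidAlgebra.coeff_sum, Finsupp.finsetSum_apply, coeff_formal]
  intro m hm hmax
  rw [hc] at hm ⊢
  obtain ⟨k, hk⟩ := Finset.card_ne_zero.1 hm
  simp only [Finset.mem_filter, Finset.mem_univ, true_and] at hk
  obtain ⟨k', hne, hk'⟩ := h k (hk ▸ m.ne_zero) fun k' => by
    by_cases h0 : a k' = 0
    · simp [h0]
    · rw [hk]
      refine hmax (Units.mk0 _ h0) ?_
      rw [hc]
      exact Finset.card_ne_zero.2 ⟨k', Finset.mem_filter.2 ⟨Finset.mem_univ _, rfl⟩⟩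
  exact Finset.one_lt_card.2 ⟨k', by simp [hk', hk], k, by simp [hk], hne⟩

/-- A term exceeding both others would be a maximum with coefficient one. -/
theorem TropNull.le_max {a b c : ℝ≥0} (h : TropNull (formal a + formal b + formal c)) :
    a ≤ max b c ∧ b ≤ max a c ∧ c ≤ max a b := by
  classical
  have aux : ∀ m : ℝ≥0, (a ≤ m) → (b ≤ m) → (c ≤ m) → (m = a ∨ m = b ∨ m = c) → m ≠ 0 →
      2 ≤ (if a = m then 1 else 0) + (if b = m then 1 else 0) + (if c = m then 1 else 0) := by
    intro m ha hb hc hm h0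
    have := h (Units.mk0 m h0) (by
      simp only [MonoidAlgebra.coeff_add, Finsupp.add_apply, coeff_formal, Units.val_mk0]
      rcases hm with rfl | rfl | rfl <;> simp) (fun t ht => by
      simp only [MonoidAlgebra.coeff_add, Finsupp.add_apply, coeff_formal] at ht
      rw [Units.val_mk0]
      by_contra hlt
      push Not at hlt
      rw [if_neg (ha.trans_lt hlt).ne, if_neg (hb.trans_lt hlt).ne,
        if_neg (hc.trans_lt hlt).ne] at ht
      exact ht rfl)
    have hco : ∀ t, (formal t).coeff (Units.mk0 m h0) = if t = m then 1 else 0 := fun t => by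
      by_cases ht : t = m <;> simp [coeff_formal, ht]
    simpa only [MonoidAlgebra.coeff_add, Finsupp.add_apply, hco] using this
  refine ⟨?_, ?_, ?_⟩ <;> by_contra! hlt <;> obtain ⟨h1, h2⟩ := max_lt_iff.1 hlt
  · have := aux a le_rfl h1.le h2.le (by simp) (zero_le.trans_lt h1).ne'
    simp [h1.ne, h2.ne] at this
  · have := aux b h1.le le_rfl h2.le (by simp) (zero_le.trans_lt h1).ne'
    simp [h1.ne, h2.ne] at this
  · have := aux c h1.le h2.le le_rfl (by simp) (zero_le.trans_lt h1).ne'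
    simp [h1.ne, h2.ne] at this

/-! ### The multiplicative form of M-convexity -/

theorem negLog_mul (a b : ℝ≥0) : negLog (a * b) = negLog a + negLog b := by
  by_cases ha : a = 0
  · simp [negLog, ha]
  by_cases hb : b = 0
  · simp [negLog, hb]
  rw [negLog, negLog, negLog, if_neg ha, if_neg hb, if_neg (mul_ne_zero ha hb), NNReal.coe_mul,
    Real.log_mul (NNReal.coe_ne_zero.2 ha) (NNReal.coe_ne_zero.2 hb), ← WithTop.coe_add, neg_add]

theorem negLog_eq_top {a : ℝ≥0} : negLog a = ⊤ ↔ a = 0 := by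
  by_cases ha : a = 0 <;> simp [negLog, ha]

theorem negLog_le_negLog {a b : ℝ≥0} : negLog a ≤ negLog b ↔ b ≤ a := by
  by_cases hb : b = 0
  · simp [hb, negLog]
  by_cases ha : a = 0
  · simp [ha, hb, negLog]
  rw [negLog, negLog, if_neg ha, if_neg hb, WithTop.coe_le_coe, neg_le_neg_iff,
    Real.log_le_log_iff (NNReal.coe_pos.2 (pos_iff_ne_zero.2 hb))
      (NNReal.coe_pos.2 (pos_iff_ne_zero.2 ha)), NNReal.coe_le_coe]

/-- The extension by zero of `ρ : Δ^r_n → ℝ≥0` to `ℤⁿ`. -/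
noncomputable def extendZ {n r : ℕ} (ρ : Delta n r → ℝ≥0) (x : Fin n → ℤ) : ℝ≥0 :=
  open Classical in if ∀ i, 0 ≤ x i then val ρ (fun i => (x i).toNat) else 0

/-- The inclusion `ℕⁿ → ℤⁿ`. -/
def toZ {n : ℕ} : (Fin n → ℕ) →+ (Fin n → ℤ) := (Nat.castAddMonoidHom ℤ).compLeft (Fin n)

theorem toZ_apply {n : ℕ} (α : Fin n → ℕ) (i : Fin n) : toZ α i = α i := rfl

theorem toZ_eps {n : ℕ} (i : Fin n) : toZ (eps i) = epsZ i := by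
  ext j
  simp [toZ_apply, eps, epsZ, Pi.single_apply]

section
variable {n r : ℕ} (ρ : Delta n r → ℝ≥0)

theorem extendZ_toZ (α : Fin n → ℕ) : extendZ ρ (toZ α) = val ρ α := by
  simp [extendZ, toZ_apply]

theorem val_ne_zero {α : Fin n → ℕ} : val ρ α ≠ 0 ↔ α ∈ supp ρ := by
  by_cases h : α ∈ Delta n r <;> simp [val, supp, h]

theorem exists_of_extendZ_ne_zero {x : Fin n → ℤ} (hx : extendZ ρ x ≠ 0) :
    ∃ α ∈ supp ρ, x = toZ α := by
  by_cases h : ∀ i, 0 ≤ x i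
  · refine ⟨fun i => (x i).toNat, ?_, ?_⟩
    · rw [← val_ne_zero]
      simpa [extendZ, h] using hx
    · ext i
      simp [toZ_apply, h i]
  · exact (hx (by simp [extendZ, h])).elim

theorem extendZ_toZ_ne_zero {α : Fin n → ℕ} : extendZ ρ (toZ α) ≠ 0 ↔ α ∈ supp ρ := by
  rw [extendZ_toZ, val_ne_zero]

theorem extendByTop_negLog (x : Fin n → ℤ) :
    extendByTop (fun α => negLog (ρ α)) x = negLog (extendZ ρ x) := by
  by_cases h1 : ∀ i, 0 ≤ x i
  · by_cases h2 : (fun i => (x i).toNat) ∈ Delta n r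
    · simp [extendByTop, extendZ, val, h1, h2]
    · simp [extendByTop, extendZ, val, h2, negLog]
  · simp [extendByTop, extendZ, h1, negLog]

theorem isMConvexFunction_iff :
    IsMConvexFunction (extendByTop fun α => negLog (ρ α)) ↔
      (supp ρ).Nonempty ∧ ∀ x y, extendZ ρ x ≠ 0 → extendZ ρ y ≠ 0 → ∀ u, y u < x u →
        ∃ v, x v < y v ∧ extendZ ρ x * extendZ ρ y ≤
          extendZ ρ (x - epsZ u + epsZ v) * extendZ ρ (y + epsZ u - epsZ v) := by
  constructor
  · rintro ⟨⟨x, hx⟩, h⟩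
    refine ⟨?_, ?_⟩
    · rw [extendByTop_negLog, Ne, negLog_eq_top] at hx
      obtain ⟨α, hα, -⟩ := exists_of_extendZ_ne_zero ρ hx
      exact ⟨α, hα⟩
    · simpa only [extendByTop_negLog, Ne, negLog_eq_top, ← negLog_mul, negLog_le_negLog] using h
  · rintro ⟨⟨α, hα⟩, h⟩
    refine ⟨⟨toZ α, ?_⟩, ?_⟩
    · rw [extendByTop_negLog, Ne, negLog_eq_top]
      exact (extendZ_toZ_ne_zero ρ).2 hα
    · simpa only [extendByTop_negLog, Ne, negLog_eq_top, ← negLog_mul, negLog_le_negLog] using h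

variable {ρ}

theorem toZ_sub_eps {α : Fin n → ℕ} {j : Fin n} (h : 0 < α j) :
    toZ (α - eps j) = toZ α - epsZ j := by
  ext i
  by_cases hi : i = j
  · subst hi
    simp [toZ_apply, eps, epsZ]
    omega
  · simp [toZ_apply, eps, epsZ, Pi.single_eq_of_ne hi]

theorem supp_subset_Delta : supp ρ ⊆ Delta n r := fun _ h => h.1

theorem deltaMinus_le {J : Set (Fin n → ℕ)} {α : Fin n → ℕ} (h : α ∈ J) (i : Fin n) :
    deltaMinus J i ≤ α i := Nat.sInf_le ⟨α, h, rfl⟩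

theorem le_deltaPlus {J : Set (Fin n → ℕ)} (hJ : J ⊆ Delta n r) {α : Fin n → ℕ} (h : α ∈ J)
    (i : Fin n) : α i ≤ deltaPlus J i := by
  refine le_csSup ⟨r, ?_⟩ ⟨α, h, rfl⟩
  rintro _ ⟨β, hβ, rfl⟩
  have : ∑ i, β i = r := hJ hβ
  exact this ▸ Finset.single_le_sum (f := β) (fun _ _ => Nat.zero_le _) (Finset.mem_univ i)

/-- A product bounded below by a nonzero one has nonzero factors, so both exchanged vectors lie in
the support. -/
theorem IsMConvexFunction.isPolymatroid
    (h : IsMConvexFunction (extendByTop fun α => negLog (ρ α))) : IsPolymatroid n r (supp ρ) := by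
  obtain ⟨hne, h⟩ := (isMConvexFunction_iff ρ).1 h
  refine ⟨supp_subset_Delta, hne, fun α hα β hβ i hi => ?_⟩
  have hα' := (extendZ_toZ_ne_zero ρ).2 hα
  have hβ' := (extendZ_toZ_ne_zero ρ).2 hβ
  obtain ⟨j, hj, hle⟩ := h (toZ β) (toZ α) hβ' hα' i (by simpa [toZ_apply] using hi)
  have hj' : β j < α j := by simpa [toZ_apply] using hj
  have hne : extendZ ρ (toZ β - epsZ i + epsZ j) * extendZ ρ (toZ α + epsZ i - epsZ j) ≠ 0 :=
    fun h0 => mul_ne_zero hβ' hα' (le_antisymm (h0 ▸ hle) zero_le)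
  refine ⟨j, hj', ?_, ?_⟩
  · rw [← extendZ_toZ_ne_zero, toZ_sub_eps (by simp only [Pi.add_apply]; omega), map_add, toZ_eps]
    exact right_ne_zero_of_mul hne
  · rw [← extendZ_toZ_ne_zero, toZ_sub_eps (by simp only [Pi.add_apply]; omega), map_add, toZ_eps,
      add_sub_right_comm]
    exact left_ne_zero_of_mul hne

/-! ### Strong and weak representations -/

theorem IsMConvexFunction.isStrongRepresentation
    (h : IsMConvexFunction (extendByTop fun α => negLog (ρ α))) :
    IsStrongRepresentation tropicalHyperfield (supp ρ) ρ := by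
  refine ⟨h.isPolymatroid, rfl, ?_⟩
  obtain ⟨-, h⟩ := (isMConvexFunction_iff ρ).1 h
  intro s _ _ α _ i j _ _ _ _
  refine tropNull_sum_formal _ fun k hk hmax => ?_
  have hterm : ∀ k, tropicalHyperfield.negOne ^ signExp i j k
      * val ρ (α + ∑ l ∈ Finset.univ.erase k, eps (i l)) * val ρ (α + eps (i k) + ∑ l, eps (j l)) =
      extendZ ρ (toZ (α + ∑ l, eps (i l)) - epsZ (i k)) *
        extendZ ρ (toZ (α + ∑ l, eps (j l)) + epsZ (i k)) := by
    intro k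
    have h1 : tropicalHyperfield.negOne = 1 := rfl
    rw [h1, one_pow, one_mul, ← extendZ_toZ, ← extendZ_toZ,
      ← Finset.add_sum_erase Finset.univ (fun l => eps (i l)) (Finset.mem_univ k)]
    simp only [map_add, toZ_eps]
    congr 2 <;> abel
  rw [hterm] at hk
  simp only [hterm] at hmax ⊢
  set X := toZ (α + ∑ l, eps (i l)) with hX
  set Y := toZ (α + ∑ l, eps (j l)) with hY
  -- A repeated index gives an identical term. Otherwise `X` exceeds `α` by exactly one at `i k`, as
  -- the exchange below needs.
  by_cases hrep : ∃ k', k' ≠ k ∧ i k' = i k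
  · obtain ⟨k', hne, heq⟩ := hrep
    exact ⟨k', hne, by rw [heq]⟩
  push Not at hrep
  have hXapp : ∀ e, X e = α e + ∑ l, (epsZ (i l) e) := by
    intro e
    simp [hX, toZ_apply, eps, epsZ, Pi.single_apply]
  have hYapp : ∀ e, (α e : ℤ) ≤ Y e := by
    intro e
    simp only [hY, toZ_apply, Pi.add_apply, Nat.cast_add]
    omega
  have hXk : X (i k) = α (i k) + 1 := by
    rw [hXapp, Finset.sum_eq_single k]
    · simp [epsZ]
    · intro l _ hl
      simp [epsZ, Pi.single_eq_of_ne (hrep l hl).symm]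
    · simp
  obtain ⟨e, he, hle⟩ := h (Y + epsZ (i k)) (X - epsZ (i k)) (right_ne_zero_of_mul hk)
    (left_ne_zero_of_mul hk) (i k) (by
      have := hYapp (i k)
      simp only [Pi.add_apply, Pi.sub_apply, hXk, epsZ, Pi.single_eq_same]
      omega)
  have hek : e ≠ i k := by
    rintro rfl
    have := hYapp (i k)
    simp only [Pi.add_apply, Pi.sub_apply, hXk, epsZ, Pi.single_eq_same] at he
    omega
  -- `X` exceeds `Y ≥ α` at `e`, which forces `e` to be one of the `i_l`; the exchanged product is
  -- then term `k'`.
  have hmem : ∃ k', i k' = e := by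
    by_contra! hno
    have h0 : X e = α e := by
      rw [hXapp, Finset.sum_eq_zero, add_zero]
      intro l _
      simp [epsZ, Pi.single_eq_of_ne (hno l).symm]
    have := hYapp e
    simp only [Pi.add_apply, Pi.sub_apply, epsZ, Pi.single_eq_of_ne hek] at he
    omega
  obtain ⟨k', rfl⟩ := hmem
  refine ⟨k', fun hkk => hek (by rw [hkk]), le_antisymm (hmax k') ?_⟩
  rw [mul_comm]
  refine hle.trans_eq ?_
  rw [mul_comm]
  congr 2 <;> abel

theorem IsStrongRepresentation.isWeakRepresentation {J : Set (Fin n → ℕ)}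
    (h : IsStrongRepresentation tropicalHyperfield J ρ) :
    IsWeakRepresentation tropicalHyperfield J ρ := by
  refine ⟨h.isPolymatroid, h.supp_eq, fun hr α hα i j k l hij hjk _ hm hp => ?_⟩
  have hmono : Monotone ![i, j, k] := by
    rw [Fin.monotone_iff_le_succ]
    intro t
    fin_cases t
    · exact hij
    · exact hjk
  have key := h.plucker 2 le_rfl hr α hα ![i, j, k] ![l] hmono
    (fun a b _ => le_of_eq (congrArg _ (Subsingleton.elim (α := Fin 1) a b))) hm (by
      simpa [Fin.sum_univ_three, add_assoc] using hp)
  have h1 : tropicalHyperfield.negOne = 1 := rfl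
  have e0 : (Finset.univ.erase (0 : Fin 3)) = {1, 2} := by decide
  have e1 : (Finset.univ.erase (1 : Fin 3)) = {0, 2} := by decide
  have e2 : (Finset.univ.erase (2 : Fin 3)) = {0, 1} := by decide
  rw [Fin.sum_univ_three] at key
  simpa [h1, e0, e1, e2, add_assoc] using key

/-- A property of quadruples that is invariant under adjacent swaps holds for all quadruples if it
holds for the sorted ones. -/
theorem forall_of_sorted {ι : Type*} [LinearOrder ι] {P : ι → ι → ι → ι → Prop}
    (h12 : ∀ i j k l, P i j k l → P j i k l) (h23 : ∀ i j k l, P i j k l → P i k j l)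
    (h34 : ∀ i j k l, P i j k l → P i j l k)
    (h : ∀ i j k l, i ≤ j → j ≤ k → k ≤ l → P i j k l) (i j k l : ι) : P i j k l := by
  have a1 : ∀ i j k l, i ≤ j → j ≤ k → P i j k l := by
    intro i j k l hij hjk
    rcases le_total k l with hkl | hlk
    · exact h i j k l hij hjk hkl
    rcases le_total j l with hjl | hlj
    · exact h34 _ _ _ _ (h i j l k hij hjl hlk)
    rcases le_total i l with hil | hli
    · exact h34 _ _ _ _ (h23 _ _ _ _ (h i l j k hil hlj hjk))
    · exact h34 _ _ _ _ (h23 _ _ _ _ (h12 _ _ _ _ (h l i j k hli hij hjk)))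
  have a2 : ∀ i j k l, i ≤ j → P i j k l := by
    intro i j k l hij
    rcases le_total j k with hjk | hkj
    · exact a1 i j k l hij hjk
    rcases le_total i k with hik | hki
    · exact h23 _ _ _ _ (a1 i k j l hik hkj)
    · exact h23 _ _ _ _ (h12 _ _ _ _ (a1 k i j l hki hij))
  rcases le_total i j with hij | hji
  · exact a2 i j k l hij
  · exact h12 _ _ _ _ (a2 j i k l hji)

theorem IsWeakRepresentation.three_term
    (h : IsWeakRepresentation tropicalHyperfield (supp ρ) ρ) (hr : 2 ≤ r) (α : Fin n → ℕ)
    (hα : α ∈ Delta n (r - 2)) (hm : deltaMinus (supp ρ) ≤ α) (i j k l : Fin n)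
    (hp : α + eps i + eps j + eps k + eps l ≤ deltaPlus (supp ρ)) :
    val ρ (α + eps i + eps j) * val ρ (α + eps k + eps l) ≤
      max (val ρ (α + eps i + eps k) * val ρ (α + eps j + eps l))
        (val ρ (α + eps i + eps l) * val ρ (α + eps j + eps k)) := by
  let V : Fin n → Fin n → ℝ≥0 := fun i j => val ρ (α + eps i + eps j)
  have hV : ∀ i j, V i j = V j i := fun i j => by simp only [V, add_right_comm]
  -- Swapping indices permutes the three products, so all three inequalities are bundled to obtain
  -- an invariant statement.
  let P : Fin n → Fin n → Fin n → Fin n → Prop := fun i j k l =>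
    α + eps i + eps j + eps k + eps l ≤ deltaPlus (supp ρ) →
      V i j * V k l ≤ max (V i k * V j l) (V i l * V j k) ∧
      V i k * V j l ≤ max (V i j * V k l) (V i l * V j k) ∧
      V i l * V j k ≤ max (V i j * V k l) (V i k * V j l)
  refine (forall_of_sorted (P := P) ?_ ?_ ?_ ?_ i j k l hp).1
  · intro i j k l H hp
    obtain ⟨h1, h2, h3⟩ := H (by rwa [add_right_comm α])
    rw [hV j i, mul_comm (V j k), mul_comm (V j l)]
    exact ⟨by rwa [max_comm], h3, h2⟩
  · intro i j k l H hp
    obtain ⟨h1, h2, h3⟩ := H (by rwa [add_right_comm (α + eps i)])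
    rw [hV k j]
    exact ⟨h2, h1, by rwa [max_comm]⟩
  · intro i j k l H hp
    obtain ⟨h1, h2, h3⟩ := H (by rwa [add_right_comm (α + eps i + eps j)])
    rw [hV l k]
    exact ⟨by rwa [max_comm], h3, h2⟩
  · intro i j k l hij hjk hkl hp
    have key := h.plucker hr α hα i j k l hij hjk hkl hm hp
    have hneg : tropicalHyperfield.negOne = 1 := rfl
    rw [hneg, one_mul] at key
    obtain ⟨h1, h2, h3⟩ := TropNull.le_max key
    change V j k * V i l ≤ max (V i k * V j l) (V i j * V k l) at h1
    change V i k * V j l ≤ max (V j k * V i l) (V i j * V k l) at h2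
    change V i j * V k l ≤ max (V j k * V i l) (V i k * V j l) at h3
    rw [mul_comm (V j k)] at h1 h2 h3
    exact ⟨by rwa [max_comm], by rwa [max_comm], by rwa [max_comm]⟩

theorem IsWeakRepresentation.isMConvexFunction
    (h : IsWeakRepresentation tropicalHyperfield (supp ρ) ρ) :
    IsMConvexFunction (extendByTop fun α => negLog (ρ α)) := by
  refine (isMConvexFunction_iff ρ).2 ⟨h.isPolymatroid.nonempty, exchange_of_local _ ?_ ?_ ?_⟩
  · intro x y hx hy
    obtain ⟨α, hα, rfl⟩ := exists_of_extendZ_ne_zero ρ hx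
    obtain ⟨β, hβ, rfl⟩ := exists_of_extendZ_ne_zero ρ hy
    have h1 : ∑ i, α i = r := hα.1
    have h2 : ∑ i, β i = r := hβ.1
    simp only [toZ_apply]
    exact_mod_cast h1.trans h2.symm
  · intro x y hx hy u hu
    obtain ⟨α, hα, rfl⟩ := exists_of_extendZ_ne_zero ρ hx
    obtain ⟨β, hβ, rfl⟩ := exists_of_extendZ_ne_zero ρ hy
    simp only [toZ_apply, Nat.cast_lt] at hu
    obtain ⟨v, hv, hmem, -⟩ := h.isPolymatroid.exchange β hβ α hα u hu
    refine ⟨v, by simpa [toZ_apply] using hv, ?_⟩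
    rw [← extendZ_toZ_ne_zero, toZ_sub_eps (by simp only [Pi.add_apply]; omega), map_add,
      toZ_eps] at hmem
    exact hmem
  · intro y i j k l hki hkj hli hlj hy hy''
    obtain ⟨β, hβ, rfl⟩ := exists_of_extendZ_ne_zero ρ hy
    obtain ⟨β', hβ', heq⟩ := exists_of_extendZ_ne_zero ρ hy''
    rw [heq]
    have happ : ∀ t, (β' t : ℤ) = β t + epsZ i t - epsZ k t + epsZ j t - epsZ l t := fun t => by
      rw [← toZ_apply, ← heq]
      rfl
    have hle : eps k + eps l ≤ β := by
      intro t
      have := happ t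
      simp only [epsZ, eps, Pi.add_apply, Pi.single_apply] at this ⊢
      split_ifs at this ⊢ <;> omega
    -- Since `k, l` avoid `i, j`, `γ` is the componentwise minimum of the two support vectors and `γ
    -- + ε_i + ε_j + ε_k + ε_l` their maximum. Hence the bounds by `δ⁻` and `δ⁺` hold and the
    -- three-term relation applies.
    obtain ⟨γ, rfl⟩ := exists_add_of_le hle
    have hβ'eq : β' = γ + eps i + eps j := by
      ext t
      have := happ t
      simp only [epsZ, eps, Pi.add_apply, Pi.single_apply] at this ⊢
      split_ifs at this ⊢ <;> omega
    subst hβ'eq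
    have hsum : ∑ t, (eps k + eps l + γ) t = r := hβ.1
    simp only [Pi.add_apply, Finset.sum_add_distrib, eps, Finset.sum_pi_single', Finset.mem_univ,
      if_true] at hsum
    have hγ : γ ∈ Delta n (r - 2) := by
      change ∑ t, γ t = r - 2
      omega
    have hm : deltaMinus (supp ρ) ≤ γ := by
      intro t
      have h1 := deltaMinus_le hβ t
      have h2 := deltaMinus_le hβ' t
      simp only [eps, Pi.add_apply, Pi.single_apply] at h1 h2
      change deltaMinus (supp ρ) t ≤ γ t
      split_ifs at h1 h2 <;> omega
    have hp : γ + eps i + eps j + eps k + eps l ≤ deltaPlus (supp ρ) := by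
      intro t
      have h1 := le_deltaPlus supp_subset_Delta hβ t
      have h2 := le_deltaPlus supp_subset_Delta hβ' t
      simp only [eps, Pi.add_apply, Pi.single_apply] at h1 h2 ⊢
      split_ifs at h1 h2 ⊢ <;> omega
    have key := h.three_term (by omega) γ hγ hm i j k l hp
    simp only [← extendZ_toZ, map_add, toZ_eps] at key ⊢
    rw [max_comm] at key
    have e1 : toZ γ + epsZ i + epsZ l = epsZ k + epsZ l + toZ γ + epsZ i - epsZ k := by abel
    have e2 : toZ γ + epsZ j + epsZ k = epsZ k + epsZ l + toZ γ + epsZ j - epsZ l := by abel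
    have e3 : toZ γ + epsZ i + epsZ k = epsZ k + epsZ l + toZ γ + epsZ i - epsZ l := by abel
    have e4 : toZ γ + epsZ j + epsZ l = epsZ k + epsZ l + toZ γ + epsZ j - epsZ k := by abel
    have e5 : toZ γ + epsZ k + epsZ l = epsZ k + epsZ l + toZ γ := by abel
    rwa [e1, e2, e3, e4, e5] at key

end

end PolymatroidRep

theorem propositionB (n r : ℕ) (ρ : PolymatroidRep.Delta n r → ℝ≥0) (J : Set (Fin n → ℕ))
    (hJ : PolymatroidRep.supp ρ = J) :
    (PolymatroidRep.IsMConvexFunction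
        (PolymatroidRep.extendByTop fun α => PolymatroidRep.negLog (ρ α)) ↔
      PolymatroidRep.IsPolymatroid n r J ∧
        PolymatroidRep.IsStrongRepresentation PolymatroidRep.tropicalHyperfield J ρ) ∧
    (PolymatroidRep.IsMConvexFunction
        (PolymatroidRep.extendByTop fun α => PolymatroidRep.negLog (ρ α)) ↔
      PolymatroidRep.IsPolymatroid n r J ∧
        PolymatroidRep.IsWeakRepresentation PolymatroidRep.tropicalHyperfield J ρ) := by
  subst hJ
  exact ⟨⟨fun h => ⟨h.isPolymatroid, h.isStrongRepresentation⟩,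
      fun h => h.2.isWeakRepresentation.isMConvexFunction⟩,
    ⟨fun h => ⟨h.isPolymatroid, h.isStrongRepresentation.isWeakRepresentation⟩,
      fun h => h.2.isMConvexFunction⟩⟩
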